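/- Let $n\ge 0$, fix a norm $\|\cdot\|$ on $\mathbb{R}^n$ (not necessarily Euclidean) and a finite set $\Phi\subset(\mathbb{R}^n)^*$ of linear functionals. For a function $f:[0,\infty)\to\mathbb{R}$, a $(\Phi,f)$-bordered set is an open set of the form $$\{x\in\mathbb{R}^n:\ \varphi(x)>C_\varphi+f(\|x\|)\ \text{ for all }\varphi\in\Phi'\}$$ for some $\emptyset\neq\Phi'\subseteq\Phi$ and constants $(C_\varphi)_{\varphi\in\Phi'}\subset\mathbb{R}$. Then there is $\varepsilon>0$, depending only on $n$, $\Phi$ and $\|\cdot\|$, such that the following holds for every $\varepsilon$-Lipschitz nondecreasing function $f:[0,\infty)\to[0,\infty)$ with $f(t)\to\infty$ as $t\to\infty$. Let $\mathfrak{U}$ be a set of open subsets of $\mathbb{R}^n$ which covers $\mathbb{R}^n$, and suppose that for every $U\in\mathfrak{U}$ there is given a $(\Phi,f)$-bordered set $E(U)$ with $U\subseteq E(U)\subsetneq\mathbb{R}^n$. Assume that the covering $\{E(U):U\in\mathfrak{U}\}$ is locally finite, i.e. every compact subset of $\mathbb{R}^n$ meets only finitely many of its elements. Then there exist $n+1$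 pairwise distinct sets $U_1,\dots,U_{n+1}\in\mathfrak{U}$ with $U_1\cap\dots\cap U_{n+1}\neq\emptyset$. Moreover, for every $x\in\mathbb{R}^n$ such $U_1,\dots,U_{n+1}$ can be chosen with, in addition, $x\in\overline{E(U_1)}$. -/

import Mathlib

open scoped NNReal

/-- `U` is a `(Φ, f)`-bordered set in `ℝⁿ` with respect to the norm `N`: an open set of the form
`{x | φ x > C φ + f (N x) for all φ ∈ Φ'}` for some nonempty `Φ' ⊆ Φ` and real constants `C φ`. -/
def IsBordered {n : ℕ} (N : Seminorm ℝ (EuclideanSpace ℝ (Fin n)))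
    (Φ : Finset (Module.Dual ℝ (EuclideanSpace ℝ (Fin n)))) (f : ℝ≥0 → ℝ)
    (U : Set (EuclideanSpace ℝ (Fin n))) : Prop :=
  IsOpen U ∧
    ∃ Φ' : Finset (Module.Dual ℝ (EuclideanSpace ℝ (Fin n))), Φ' ⊆ Φ ∧ Φ'.Nonempty ∧
      ∃ C : Module.Dual ℝ (EuclideanSpace ℝ (Fin n)) → ℝ,
        U = {x | ∀ φ ∈ Φ', φ x > C φ + f ⟨N x, apply_nonneg N x⟩}

/-- A collection of sets is locally finite if every compact set meets only finitely many of its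
elements. -/
def IsLocallyFiniteCollection {X : Type*} [TopologicalSpace X] (𝒱 : Set (Set X)) : Prop :=
  ∀ K : Set X, IsCompact K → {V ∈ 𝒱 | (V ∩ K).Nonempty}.Finite

/-! Fix `x`. If `x ∉ closure (E U)`, some defining inequality of `E U` fails at `x`, so `φ (y - x) >
f (N y) - f (N x)` on `U` for some `φ ∈ Φ` ("type `false`"). Otherwise some `φ` has `φ (y - x) > 0`
on `U` far from the origin, as `f → ∞` ("type `true`"). Uniting the members with equal functional
and type leaves a finite cover.

With a subordinate partition of unity, average the vectors representing the functionals into a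
vector field. On a large sphere about `x` it points outward. It must not vanish where only type
`false` weights occur. There a zero needs positively dependent functionals, which forces `N y < N x`
since `f` is monotone. So subtract `s • rep l`, where `l` supports `N` at `x` and the polynomial `s`
in the type `false` weights detects dependence. As `f` is `ε`-Lipschitz and `l (y - x) ≤ N y - N x`,
the corrected field has no zero there.

By a Brouwer argument (`exists_zero_of_outward`) the field takes every small value `c` at a point
carrying a type `true` weight. The field is a `C¹` function `G` of the weights, and `G` maps the
weight vectors with at most `n` nonzero entries to a set of dimension below `n`
(`dense_compl_image_skeleton`). Choosing `c` outside this set makes `n + 1` weights nonzero. -/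

/-! ### No `C¹` retraction onto the sphere, by volume. -/

open MeasureTheory Metric Set Polynomial in
/-- `det (1 + A)` is a fixed affine combination of the numbers `det (1 + t A)` with `t` small. -/
theorem exists_det_one_add_eq_sum {E : Type*} [AddCommGroup E] [Module ℝ E]
    [FiniteDimensional ℝ E] {c : ℝ} (hc : 0 < c) :
    ∃ (s : Finset ℕ) (t l : ℕ → ℝ), (∀ i ∈ s, 0 < t i ∧ t i < c) ∧ ∑ i ∈ s, l i = 1 ∧
      ∀ A : E →ₗ[ℝ] E, LinearMap.det (1 + A) = ∑ i ∈ s, l i * LinearMap.det (1 + t i • A) := by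
  classical
  let d := Module.finrank ℝ E
  let s := Finset.range (d + 1)
  -- `d + 1` distinct nodes determine a polynomial of degree at most `d`; the `+ 2` keeps even the
  -- node at `i = 0` strictly below `c`.
  let t : ℕ → ℝ := fun i ↦ c / (i + 2)
  have ht : Set.InjOn t s := by
    intro i _ j _ hij
    have h : (i : ℝ) + 2 = j + 2 := by
      have h1 : c / ((i : ℝ) + 2) = c / (j + 2) := hij
      rw [div_eq_div_iff (by positivity) (by positivity)] at h1
      exact (mul_left_cancel₀ hc.ne' h1).symm
    exact_mod_cast add_right_cancel h
  refine ⟨s, t, fun i ↦ (Lagrange.basis s t i).eval 1, fun i _ ↦ ⟨by positivity, ?_⟩, ?_, fun A ↦ ?_⟩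
  · rw [div_lt_iff₀ (by positivity)]
    have : (0 : ℝ) ≤ i := by positivity
    nlinarith
  · rw [← eval_finsetSum, Lagrange.sum_basis ht ⟨0, by simp [s]⟩, eval_one]
  · let b := Module.finBasis ℝ E
    let M := LinearMap.toMatrix b b A
    let p : ℝ[X] := Matrix.det ((X : ℝ[X]) • M.map C + (1 : Matrix _ _ ℝ).map C)
    have hp (u : ℝ) : p.eval u = LinearMap.det (1 + u • A) := by
      rw [← LinearMap.det_toMatrix b, ← coe_evalRingHom, RingHom.map_det]
      congr 1
      ext i j
      simp only [RingHom.mapMatrix_apply, Matrix.map_apply, Matrix.add_apply, Matrix.smul_apply,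
        map_add, map_smul, LinearMap.toMatrix_one, M, smul_eq_mul, coe_evalRingHom,
        eval_C]
      rw [eval_mul, eval_X, eval_C, add_comm]
    have hdeg : p.degree < s.card := by
      refine lt_of_le_of_lt Polynomial.degree_le_natDegree ?_
      have := natDegree_det_X_add_C_le M 1
      simp only [Fintype.card_fin] at this
      simp only [s, Finset.card_range]
      exact_mod_cast Nat.lt_succ_of_le this
    have h := congrArg (eval 1) (Lagrange.eq_interpolate ht hdeg)
    rw [Lagrange.interpolate_apply, eval_finsetSum, hp, one_smul] at h
    rw [h]
    refine Finset.sum_congr rfl fun i _ ↦ ?_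
    rw [eval_mul, eval_C, hp, mul_comm]

/-- An operator of the form `1 + t A` with `t ‖A‖ < 1` has positive determinant. -/
theorem det_one_add_smul_pos {E : Type*} [NormedAddCommGroup E] [NormedSpace ℝ E]
    [FiniteDimensional ℝ E] (A : E →L[ℝ] E) {t : ℝ} (ht : 0 ≤ t) (hA : t * ‖A‖ < 1) :
    0 < LinearMap.det (1 + t • (A : E →ₗ[ℝ] E)) := by
  -- The determinant is `1` at `u = 0` and never vanishes on `[0, t]`, so it cannot change sign.
  have hne (u : ℝ) (hu : u ∈ Set.Icc 0 t) : LinearMap.det (1 + u • (A : E →ₗ[ℝ] E)) ≠ 0 := by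
    intro h0
    obtain ⟨v, hv, hv0⟩ := (Submodule.ne_bot_iff _).1
      (LinearMap.bot_lt_ker_of_det_eq_zero h0).ne'
    have h1 : v = -(u • A v) := by
      have : v + u • A v = 0 := by simpa using hv
      exact eq_neg_of_add_eq_zero_left this
    have h2 : ‖v‖ ≤ u * (‖A‖ * ‖v‖) := by
      calc ‖v‖ = ‖u • A v‖ := by rw [← norm_neg (u • A v), ← h1]
        _ = u * ‖A v‖ := by rw [norm_smul, Real.norm_of_nonneg hu.1]
        _ ≤ _ := mul_le_mul_of_nonneg_left (A.le_opNorm v) hu.1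
    have h3 : 0 < ‖v‖ := norm_pos_iff.2 hv0
    have h4 : u * ‖A‖ ≤ t * ‖A‖ := mul_le_mul_of_nonneg_right hu.2 (norm_nonneg _)
    nlinarith
  have hcont : Continuous fun u : ℝ ↦ LinearMap.det (1 + u • (A : E →ₗ[ℝ] E)) := by
    have : Continuous fun u : ℝ ↦ (1 + u • A).det :=
      ContinuousLinearMap.continuous_det.comp (by fun_prop)
    exact this
  by_contra hneg
  obtain ⟨u, hu, h0⟩ := intermediate_value_Icc' ht hcont.continuousOn
    (show (0 : ℝ) ∈ Set.Icc _ _ from ⟨not_lt.1 hneg, by simp⟩)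
  exact hne u hu h0

open MeasureTheory Metric Set in
/-- A map which is the identity outside of a ball and a Lipschitz perturbation of the identity
with constant less than one maps the open ball bijectively onto itself. -/
theorem image_ball_of_lipschitz_perturbation {E : Type*} [NormedAddCommGroup E] [NormedSpace ℝ E]
    [FiniteDimensional ℝ E] {R : ℝ} {g : E → E} {K : ℝ≥0} (hg : LipschitzWith K g)
    (h0 : ∀ y ∉ ball (0 : E) R, g y = 0) (hK : K < 1) :
    Function.Injective (fun y ↦ y + g y) ∧ (fun y ↦ y + g y) '' ball 0 R = ball 0 R := by
  have happ : ApproximatesLinearOn (fun y ↦ y + g y)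
      ((ContinuousLinearEquiv.refl ℝ E : E ≃L[ℝ] E) : E →L[ℝ] E) univ K := by
    intro x _ y _
    have := hg.norm_sub_le x y
    have e : x + g x - (y + g y) - (x - y) = g x - g y := by abel
    simpa [e] using this
  have hlt : Subsingleton E ∨
      K < ‖((ContinuousLinearEquiv.refl ℝ E).symm : E →L[ℝ] E)‖₊⁻¹ := by
    rcases subsingleton_or_nontrivial E with h | h
    · exact Or.inl h
    · right
      have : ‖((ContinuousLinearEquiv.refl ℝ E).symm : E →L[ℝ] E)‖₊ = 1 := by
        have : ((ContinuousLinearEquiv.refl ℝ E).symm : E →L[ℝ] E) = ContinuousLinearMap.id ℝ E := rfl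
        rw [this]
        exact NNReal.eq ContinuousLinearMap.norm_id
      simpa [this] using hK
  let e := happ.toHomeomorph _ hlt
  have he : ∀ y, e y = y + g y := fun y ↦ rfl
  have hinj : Function.Injective (fun y ↦ y + g y) := e.injective
  have hsurj : Function.Surjective (fun y ↦ y + g y) := e.surjective
  refine ⟨hinj, ?_⟩
  ext z
  constructor
  · rintro ⟨y, hy, rfl⟩
    by_contra hz
    have : y + g y = y := hinj (by simp [h0 _ hz])
    simp only [this] at hz
    exact hz hy
  · intro hz
    obtain ⟨y, rfl⟩ := hsurj z
    refine ⟨y, ?_, rfl⟩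
    by_contra hy
    simp only [h0 y hy, add_zero] at hz
    exact hy hz

open MeasureTheory Metric Set in
/-- There is no `C¹` retraction of a ball onto its boundary sphere. -/
theorem no_contDiffOn_retraction {E : Type*} [NormedAddCommGroup E] [InnerProductSpace ℝ E]
    [FiniteDimensional ℝ E] {R : ℝ} (hR : 0 < R) {r : E → E}
    (hr : ContDiffOn ℝ 1 r (closedBall 0 R)) (hnorm : ∀ y ∈ closedBall (0 : E) R, ‖r y‖ = R)
    (hid : ∀ y ∈ sphere (0 : E) R, r y = y) : False := by
  classical
  let _ : MeasurableSpace E := borel E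
  have : BorelSpace E := ⟨rfl⟩
  let μ : Measure E := Measure.addHaar
  let g : E → E := fun y ↦ if y ∈ ball 0 R then r y - y else 0
  have hgB : ∀ y ∈ closedBall (0 : E) R, g y = r y - y := by
    intro y hy
    by_cases h : y ∈ ball (0 : E) R
    · exact if_pos h
    · have hs : y ∈ sphere (0 : E) R := by
        simp only [mem_closedBall, mem_ball, mem_sphere] at *
        exact le_antisymm hy (not_lt.1 h)
      rw [hid y hs, sub_self]
      exact if_neg h
  have hg0 : ∀ y ∉ ball (0 : E) R, g y = 0 := fun y hy ↦ if_neg hy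
  obtain ⟨K, hK⟩ := (hr.sub contDiffOn_id).exists_lipschitzOnWith one_ne_zero
    (convex_closedBall (0 : E) R) (isCompact_closedBall 0 R)
  -- A segment leaving the ball meets the sphere, where `g` vanishes, so extension by zero keeps the
  -- Lipschitz constant.
  have key : ∀ y ∈ ball (0 : E) R, ∀ z ∉ ball (0 : E) R, ‖g y - g z‖ ≤ K * ‖y - z‖ := by
    intro y hy z hz
    obtain ⟨w, hw, hwR⟩ : ∃ w ∈ segment ℝ y z, ‖w‖ = R := by
      have := (convex_segment (𝕜 := ℝ) y z).isPreconnected.intermediate_value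
        (left_mem_segment ℝ y z) (right_mem_segment ℝ y z) (f := fun w ↦ ‖w‖)
        continuous_norm.continuousOn
      obtain ⟨w, hw, h⟩ := this (show R ∈ Icc _ _ from
        ⟨by simpa using (mem_ball.1 hy).le, by simpa using hz⟩)
      exact ⟨w, hw, h⟩
    have hgw : g w = 0 := hg0 w (by simp [hwR])
    have h1 := hK.norm_sub_le (ball_subset_closedBall hy)
      (show w ∈ closedBall (0 : E) R by simp [hwR])
    have hw' : w ∈ closedBall (0 : E) R := by simp [hwR]
    simp only [id] at h1
    rw [← hgB y (ball_subset_closedBall hy), ← hgB w hw', hgw] at h1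
    rw [hg0 z hz]
    refine h1.trans (mul_le_mul_of_nonneg_left ?_ K.2)
    have := dist_add_dist_of_mem_segment hw
    rw [← dist_eq_norm, ← dist_eq_norm, ← this]
    exact le_add_of_nonneg_right dist_nonneg
  have hgL : LipschitzWith K g := by
    refine LipschitzWith.of_dist_le_mul fun y z ↦ ?_
    rw [dist_eq_norm, dist_eq_norm]
    by_cases hy : y ∈ ball (0 : E) R <;> by_cases hz : z ∈ ball (0 : E) R
    · have h1 := hK.norm_sub_le (ball_subset_closedBall hy) (ball_subset_closedBall hz)
      simp only [id] at h1
      rwa [← hgB y (ball_subset_closedBall hy), ← hgB z (ball_subset_closedBall hz)] at h1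
    · exact key y hy z hz
    · rw [norm_sub_rev, norm_sub_rev y z]
      exact key z hz y hy
    · simp [hg0 y hy, hg0 z hz]; positivity
  have hrd : ∀ y ∈ ball (0 : E) R, HasFDerivAt r (fderiv ℝ r y) y := fun y hy ↦
    ((hr.contDiffAt (mem_nhds_iff.2 ⟨ball 0 R, ball_subset_closedBall, isOpen_ball, hy⟩)
      ).differentiableAt one_ne_zero).hasFDerivAt
  let D : E → E →L[ℝ] E := fun y ↦ fderiv ℝ r y - ContinuousLinearMap.id ℝ E
  have hgd : ∀ y ∈ ball (0 : E) R, HasFDerivAt g (D y) y := by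
    intro y hy
    refine ((hrd y hy).sub (hasFDerivAt_id y)).congr_of_eventuallyEq ?_
    filter_upwards [isOpen_ball.mem_nhds hy] with z hz
    exact hgB z (ball_subset_closedBall hz)
  have hDK : ∀ y ∈ ball (0 : E) R, ‖D y‖ ≤ K := fun y hy ↦ (hgd y hy).le_of_lipschitz hgL
  -- For such `t` the map `y + t • g y` permutes the ball, so its Jacobian integrates to the volume.
  -- The integral is polynomial in `t`, so this persists at `t = 1`.
  have hvol : ∀ t : ℝ, 0 < t → t < (K + 1 : ℝ)⁻¹ →
      IntegrableOn (fun y ↦ LinearMap.det (1 + t • (D y : E →ₗ[ℝ] E))) (ball 0 R) μ ∧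
      ∫ y in ball (0 : E) R, LinearMap.det (1 + t • (D y : E →ₗ[ℝ] E)) ∂μ
        = μ.real (ball (0 : E) R) := by
    intro t ht htK
    have htK1 : t * K < 1 := by
      rw [lt_inv_comm₀ ht (by positivity)] at htK
      have := mul_lt_mul_of_pos_left htK ht
      rw [mul_inv_cancel₀ ht.ne'] at this
      nlinarith
    let T : ℝ≥0 := ⟨t, ht.le⟩
    obtain ⟨hinj, himg⟩ := image_ball_of_lipschitz_perturbation (R := R) (g := fun y ↦ t • g y)
      (K := T * K) (LipschitzWith.of_dist_le_mul fun y z ↦ by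
        have := hgL.dist_le_mul y z
        rw [dist_smul₀, Real.norm_of_nonneg ht.le, NNReal.coe_mul, mul_assoc]
        exact mul_le_mul_of_nonneg_left this ht.le)
      (fun y hy ↦ by simp [hg0 y hy]) (by exact_mod_cast htK1)
    have hd : ∀ y ∈ ball (0 : E) R, HasFDerivWithinAt (fun y ↦ y + t • g y)
        (ContinuousLinearMap.id ℝ E + t • D y) (ball 0 R) y := fun y hy ↦
      ((hasFDerivAt_id y).add ((hgd y hy).const_smul t)).hasFDerivWithinAt
    have hpos : ∀ y ∈ ball (0 : E) R,
        |(ContinuousLinearMap.id ℝ E + t • D y).det| • (1 : ℝ)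
          = LinearMap.det (1 + t • (D y : E →ₗ[ℝ] E)) := by
      intro y hy
      rw [smul_eq_mul, mul_one]
      refine abs_of_pos (det_one_add_smul_pos (D y) ht.le (lt_of_le_of_lt ?_ htK1))
      exact mul_le_mul_of_nonneg_left (hDK y hy) ht.le
    have h1 := integral_image_eq_integral_abs_det_fderiv_smul μ measurableSet_ball hd
      hinj.injOn (fun _ ↦ (1 : ℝ))
    have h2 := integrableOn_image_iff_integrableOn_abs_det_fderiv_smul μ measurableSet_ball hd
      hinj.injOn (fun _ ↦ (1 : ℝ))
    rw [himg] at h1 h2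
    refine ⟨?_, ?_⟩
    · refine (h2.1 (integrableOn_const measure_ball_lt_top.ne)).congr_fun ?_ measurableSet_ball
      exact hpos
    · rw [← setIntegral_congr_fun measurableSet_ball hpos, ← h1]
      simp
  obtain ⟨s, t, l, ht, hl, hdet⟩ := exists_det_one_add_eq_sum (E := E)
    (show (0 : ℝ) < (K + 1 : ℝ)⁻¹ by positivity)
  -- Constancy of `‖r‖` makes the range of the derivative orthogonal to `r y ≠ 0`.
  have hzero : ∀ y ∈ ball (0 : E) R, LinearMap.det (1 + (D y : E →ₗ[ℝ] E)) = 0 := by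
    intro y hy
    have e : (1 + (D y : E →ₗ[ℝ] E)) = (fderiv ℝ r y : E →ₗ[ℝ] E) := by
      ext v; simp [D]
    rw [e]
    by_contra hne
    have hsurj : Function.Surjective (fderiv ℝ r y) :=
      (LinearEquiv.ofIsUnitDet (f := (fderiv ℝ r y : E →ₗ[ℝ] E)) (v := Module.finBasis ℝ E)
        (v' := Module.finBasis ℝ E) (by
          rw [LinearMap.det_toMatrix]; exact isUnit_iff_ne_zero.2 hne)).surjective
    have hconst : HasFDerivAt (fun z ↦ ‖r z‖ ^ 2) (0 : E →L[ℝ] ℝ) y := by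
      refine (hasFDerivAt_const (R ^ 2) y).congr_of_eventuallyEq ?_
      filter_upwards [isOpen_ball.mem_nhds hy] with z hz
      rw [hnorm z (ball_subset_closedBall hz)]
    have huniq := ((hrd y hy).norm_sq).unique hconst
    obtain ⟨v, hv⟩ := hsurj (r y)
    have h3 : (2 : ℝ) * inner ℝ (r y) (fderiv ℝ r y v) = 0 := by
      have h4 := DFunLike.congr_fun huniq v
      rw [_root_.smul_apply, ContinuousLinearMap.comp_apply, innerSL_apply_apply,
        _root_.zero_apply, nsmul_eq_mul] at h4
      exact_mod_cast h4
    rw [hv, real_inner_self_eq_norm_sq, hnorm y (ball_subset_closedBall hy)] at h3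
    nlinarith
  have hsum : ∫ y in ball (0 : E) R, LinearMap.det (1 + (D y : E →ₗ[ℝ] E)) ∂μ
      = μ.real (ball (0 : E) R) := by
    rw [setIntegral_congr_fun measurableSet_ball fun y _ ↦ hdet (D y), integral_finsetSum]
    · have : ∀ i ∈ s, ∫ y in ball (0 : E) R, l i * LinearMap.det (1 + t i • (D y : E →ₗ[ℝ] E)) ∂μ
          = l i * μ.real (ball (0 : E) R) := by
        intro i hi
        rw [integral_const_mul, (hvol (t i) (ht i hi).1 (ht i hi).2).2]
      rw [Finset.sum_congr rfl this, ← Finset.sum_mul, hl, one_mul]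
    · exact fun i hi ↦ (hvol (t i) (ht i hi).1 (ht i hi).2).1.const_mul _
  rw [setIntegral_congr_fun measurableSet_ball hzero, integral_zero] at hsum
  have : 0 < μ.real (ball (0 : E) R) :=
    ENNReal.toReal_pos (measure_ball_pos μ _ hR).ne' measure_ball_lt_top.ne
  linarith

/-! ### Values of outward vector fields. -/

open Metric Set in
/-- A `C¹` vector field pointing outward along the boundary of a ball has a zero in the ball. -/
theorem exists_zero_of_outward {E : Type*} [NormedAddCommGroup E] [InnerProductSpace ℝ E]
    [FiniteDimensional ℝ E] {R : ℝ} (hR : 0 < R) {F : E → E} (hF : ContDiff ℝ 1 F)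
    (hout : ∀ y ∈ sphere (0 : E) R, 0 < inner ℝ y (F y)) :
    ∃ y ∈ closedBall (0 : E) R, F y = 0 := by
  by_contra! hne
  obtain ⟨M, hM0, hM⟩ : ∃ M : ℝ, 0 < M ∧ ∀ y ∈ closedBall (0 : E) R,
      y + (M * (R ^ 2 - ‖y‖ ^ 2)) • F y ≠ 0 := by
    -- Off `S` the pairing with `y` is positive. On `S`, a compact part of the open ball, a large
    -- `M` makes the second summand longer than `y`.
    let S := closedBall (0 : E) R ∩ {y | inner ℝ y (F y) ≤ 0}
    have hS : IsCompact S := (isCompact_closedBall 0 R).inter_right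
      (isClosed_le (continuous_id.inner hF.continuous) continuous_const)
    have hpos : ∀ y ∈ S, 0 < (R ^ 2 - ‖y‖ ^ 2) * ‖F y‖ := by
      intro y hy
      have h1 : ‖y‖ < R := by
        refine lt_of_le_of_ne (by simpa using hy.1) fun h ↦ ?_
        exact (hout y (by simpa using h)).not_ge hy.2
      have := norm_nonneg y
      exact mul_pos (by nlinarith) (norm_pos_iff.2 (hne y hy.1))
    obtain ⟨m, hm, hmS⟩ : ∃ m : ℝ, 0 < m ∧ ∀ y ∈ S, m ≤ (R ^ 2 - ‖y‖ ^ 2) * ‖F y‖ := by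
      rcases S.eq_empty_or_nonempty with h | h
      · exact ⟨1, one_pos, by simp [h]⟩
      · obtain ⟨y, hy, hmin⟩ := hS.exists_isMinOn h
          (f := fun y ↦ (R ^ 2 - ‖y‖ ^ 2) * ‖F y‖) (by
            have := hF.continuous; fun_prop)
        exact ⟨_, hpos y hy, fun z hz ↦ hmin hz⟩
    refine ⟨(R + 1) / m, by positivity, fun y hy h0 ↦ ?_⟩
    have hyR : ‖y‖ ≤ R := by simpa using hy
    have hnn : 0 ≤ R ^ 2 - ‖y‖ ^ 2 := by nlinarith [norm_nonneg y]
    by_cases hyS : inner ℝ y (F y) ≤ 0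
    · have h1 := hmS y ⟨hy, hyS⟩
      have h2 : ‖y‖ = (R + 1) / m * (R ^ 2 - ‖y‖ ^ 2) * ‖F y‖ := by
        conv_lhs => rw [eq_neg_of_add_eq_zero_left h0, norm_neg, norm_smul,
          Real.norm_of_nonneg (by positivity)]
      have h3 : (R + 1) / m * m ≤ (R + 1) / m * ((R ^ 2 - ‖y‖ ^ 2) * ‖F y‖) :=
        mul_le_mul_of_nonneg_left h1 (by positivity)
      rw [div_mul_cancel₀ _ hm.ne'] at h3
      nlinarith
    · have h1 : inner ℝ y (y + ((R + 1) / m * (R ^ 2 - ‖y‖ ^ 2)) • F y) = 0 := by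
        rw [h0, inner_zero_right]
      rw [inner_add_right, inner_smul_right, real_inner_self_eq_norm_sq] at h1
      push Not at hyS
      have h2 : 0 ≤ (R + 1) / m * (R ^ 2 - ‖y‖ ^ 2) * inner ℝ y (F y) := by positivity
      have h3 : y = 0 := by
        rw [← norm_eq_zero]; nlinarith [sq_nonneg ‖y‖]
      simp [h3] at hyS
  let H : E → E := fun y ↦ y + (M * (R ^ 2 - ‖y‖ ^ 2)) • F y
  have hH : ContDiff ℝ 1 H := contDiff_id.add
    ((contDiff_const.mul (contDiff_const.sub (contDiff_norm_sq ℝ))).smul hF)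
  refine no_contDiffOn_retraction hR (r := fun y ↦ (R * ‖H y‖⁻¹) • H y) ?_ ?_ ?_
  · refine ContDiffOn.smul (contDiffOn_const.mul (ContDiffOn.inv ?_ ?_)) hH.contDiffOn
    · exact hH.contDiffOn.norm ℝ hM
    · exact fun y hy ↦ norm_ne_zero_iff.2 (hM y hy)
  · intro y hy
    have : 0 < ‖H y‖ := norm_pos_iff.2 (hM y hy)
    rw [norm_smul, Real.norm_of_nonneg (by positivity), mul_assoc, inv_mul_cancel₀ this.ne', mul_one]
  · intro y hy
    have hy' : ‖y‖ = R := by simpa using hy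
    have : H y = y := by simp [H, hy']
    simp only [this, hy', mul_inv_cancel₀ hR.ne', one_smul]

open Metric Set in
/-- A `C¹` vector field pointing outward along the boundary of a ball and vanishing nowhere on the
part of the ball outside of an open set `W` takes on `W` a value outside of any given set with dense
complement. -/
theorem exists_notMem_of_outward {E : Type*} [NormedAddCommGroup E] [InnerProductSpace ℝ E]
    [FiniteDimensional ℝ E] {R : ℝ} (hR : 0 < R) {F : E → E} (hF : ContDiff ℝ 1 F) (x : E)
    (hout : ∀ y ∈ sphere x R, 0 < inner ℝ (y - x) (F y)) {W Z : Set E} (hW : IsOpen W)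
    (hne : ∀ y ∉ W, F y ≠ 0) (hZ : Dense Zᶜ) : ∃ y ∈ W, F y ∉ Z := by
  have hFc : Continuous F := hF.continuous
  obtain ⟨a, ha, haW⟩ : ∃ a : ℝ, 0 < a ∧ ∀ y ∈ closedBall x R \ W, a ≤ ‖F y‖ := by
    rcases (closedBall x R \ W).eq_empty_or_nonempty with h | h
    · exact ⟨1, one_pos, by simp [h]⟩
    · obtain ⟨y, hy, hmin⟩ := ((isCompact_closedBall x R).diff hW).exists_isMinOn h
        (f := fun y ↦ ‖F y‖) (by fun_prop)
      exact ⟨_, norm_pos_iff.2 (hne y hy.2), fun z hz ↦ hmin hz⟩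
  obtain ⟨b, hb, hbS⟩ : ∃ b : ℝ, 0 < b ∧ ∀ y ∈ sphere x R, b ≤ inner ℝ (y - x) (F y) := by
    rcases (sphere x R).eq_empty_or_nonempty with h | h
    · exact ⟨1, one_pos, by simp [h]⟩
    · obtain ⟨y, hy, hmin⟩ := (isCompact_sphere x R).exists_isMinOn h
        (f := fun y ↦ inner ℝ (y - x) (F y)) (by fun_prop)
      exact ⟨_, hout y hy, fun z hz ↦ hmin hz⟩
  -- `‖c‖ < b / R` keeps `F - c` outward; `‖c‖ < a` forces its zero into `W`.
  obtain ⟨c, hcZ, hc⟩ := hZ.exists_dist_lt 0 (lt_min ha (div_pos hb hR))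
  rw [dist_zero_left, lt_min_iff, lt_div_iff₀ hR] at hc
  obtain ⟨y, hy, hy0⟩ := exists_zero_of_outward hR (F := fun y ↦ F (x + y) - c)
    ((hF.comp (contDiff_const.add contDiff_id)).sub contDiff_const) (by
      intro y hy
      have h1 := hbS (x + y) (by simpa using hy)
      rw [add_sub_cancel_left] at h1
      have h2 := real_inner_le_norm y c
      rw [show ‖y‖ = R by simpa using hy] at h2
      rw [inner_sub_right]
      linarith)
  have hyc : F (x + y) = c := sub_eq_zero.1 hy0
  refine ⟨x + y, ?_, by rwa [hyc]⟩
  by_contra hyW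
  have := haW (x + y) ⟨by simpa using hy, hyW⟩
  rw [hyc] at this
  linarith

/-! ### Images of low-dimensional skeleta. -/

open Set in
/-- The image under a `C¹` map to `E` of the part of the standard simplex consisting of points with
at most `dim E` nonzero coordinates has dense complement. -/
theorem dense_compl_image_skeleton {E : Type*} [NormedAddCommGroup E] [NormedSpace ℝ E]
    [FiniteDimensional ℝ E] {I : Type*} [Fintype I] {G : (I → ℝ) → E} (hG : ContDiff ℝ 1 G) :
    Dense (G '' {w | ∑ i, w i = 1 ∧
      (Finset.univ.filter fun i ↦ w i ≠ 0).card ≤ Module.finrank ℝ E})ᶜ := by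
  classical
  rcases Nat.eq_zero_or_pos (Module.finrank ℝ E) with h0 | hpos
  · convert dense_univ
    rw [compl_univ_iff, image_eq_empty, eq_empty_iff_forall_notMem]
    rintro w ⟨h1, h2⟩
    have h3 : ∀ i, w i = 0 := by simpa [h0, Finset.filter_eq_empty_iff] using h2
    simp [h3] at h1
  -- Charts of the skeleton: the coordinates in `A` are free and the coordinate `p.1` makes the sum
  -- `1`, so fewer than `dim E` parameters suffice.
  let T : (p : I × {A : Finset I // A.card < Module.finrank ℝ E}) → (p.2.1 → ℝ) → I → ℝ :=
    fun p u i ↦ if h : i ∈ p.2.1 then u ⟨i, h⟩ else if i = p.1 then 1 - ∑ j, u j else 0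
  have hT : ∀ p, ContDiff ℝ 1 (T p) := by
    refine fun p ↦ contDiff_pi.2 fun i ↦ ?_
    by_cases h : i ∈ p.2.1
    · simpa only [T, h, dite_true] using contDiff_apply ℝ ℝ _
    · by_cases h' : i = p.1
      · have : (fun u ↦ T p u i) = fun u ↦ 1 - ∑ j, u j := by
          funext u; simp only [T, h, dite_false]; rw [if_pos h']
        rw [this]
        exact contDiff_const.sub (ContDiff.sum fun j _ ↦ contDiff_apply ℝ ℝ j)
      · have : (fun u ↦ T p u i) = fun u ↦ 0 := by
          funext u; simp only [T, h, dite_false]; rw [if_neg h']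
        rw [this]
        exact contDiff_const
  have hdim : dimH (⋃ p, range (G ∘ T p)) < Module.finrank ℝ E := by
    rw [dimH_iUnion]
    refine lt_of_le_of_lt (b := ((Module.finrank ℝ E - 1 : ℕ) : ENNReal)) (iSup_le fun p ↦ ?_)
      (by exact_mod_cast Nat.sub_lt hpos one_pos)
    refine (hG.comp (hT p)).dimH_range_le.trans ?_
    have := p.2.2
    rw [Module.finrank_fintype_fun_eq_card, Fintype.card_coe]
    exact_mod_cast Nat.le_sub_one_of_lt this
  refine (dense_compl_of_dimH_lt_finrank hdim).mono (compl_subset_compl.2 ?_)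
  rintro _ ⟨w, ⟨h1, h2⟩, rfl⟩
  obtain ⟨i₀, hi₀⟩ : ∃ i, w i ≠ 0 := by
    by_contra! h
    simp [h] at h1
  let A := (Finset.univ.filter fun i ↦ w i ≠ 0).erase i₀
  have hmem : i₀ ∈ Finset.univ.filter fun i ↦ w i ≠ 0 := by simpa using hi₀
  have hA : A.card < Module.finrank ℝ E := by
    have : A.card < (Finset.univ.filter fun i ↦ w i ≠ 0).card := Finset.card_erase_lt_of_mem hmem
    exact this.trans_le h2
  refine mem_iUnion.2 ⟨(i₀, ⟨A, hA⟩), fun i ↦ w i, ?_⟩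
  simp only [Function.comp]
  congr 1
  funext i
  by_cases h : i ∈ A
  · simp only [T, h, dite_true]
  · simp only [T, h, dite_false]
    split_ifs with h'
    · subst h'
      have h3 : ∑ j : A, w j = ∑ j ∈ A, w j := Finset.sum_coe_sort A w
      have h4 := Finset.sum_erase_add _ w hmem
      rw [Finset.sum_filter_ne_zero, h1] at h4
      rw [h3]
      linarith
    · by_contra hne
      exact h (Finset.mem_erase.2 ⟨h', by simpa using Ne.symm hne⟩)

/-! ### Positive dependence. -/

open Classical in
/-- A polynomial in the nonnegative weights `a` which is positive exactly when the vectors of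
positive weight are positively dependent, i.e. some of them have the origin in their convex hull. -/
noncomputable def positiveDependence {ι E : Type*} [Fintype ι] [AddCommGroup E] [Module ℝ E]
    (v : ι → E) (a : ι → ℝ) : ℝ :=
  ∑ S ∈ Finset.univ.filter (fun S : Finset ι ↦ ∃ b : ι → ℝ, (∀ i ∈ S, 0 ≤ b i) ∧
    ∑ i ∈ S, b i = 1 ∧ ∑ i ∈ S, b i • v i = 0), ∏ i ∈ S, a i

section positiveDependence

variable {ι E : Type*} [Fintype ι]

theorem positiveDependence_nonneg [AddCommGroup E] [Module ℝ E] (v : ι → E) {a : ι → ℝ}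
    (ha : ∀ i, 0 ≤ a i) : 0 ≤ positiveDependence v a :=
  Finset.sum_nonneg fun _ _ ↦ Finset.prod_nonneg fun i _ ↦ ha i

theorem exists_of_positiveDependence_ne_zero [AddCommGroup E] [Module ℝ E] {v : ι → E}
    {a : ι → ℝ} (ha : positiveDependence v a ≠ 0) :
    ∃ (S : Finset ι) (b : ι → ℝ), (∀ i ∈ S, 0 ≤ b i) ∧ ∑ i ∈ S, b i = 1 ∧
      ∑ i ∈ S, b i • v i = 0 ∧ ∀ i ∈ S, a i ≠ 0 := by
  classical
  obtain ⟨S, hS, h⟩ := Finset.exists_ne_zero_of_sum_ne_zero ha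
  obtain ⟨b, hb⟩ := (Finset.mem_filter.1 hS).2
  exact ⟨S, b, hb.1, hb.2.1, hb.2.2, Finset.prod_ne_zero_iff.1 h⟩

/-- The support of `a` is itself one of the dependent index sets, and its monomial is positive. -/
theorem positiveDependence_pos [AddCommGroup E] [Module ℝ E] {v : ι → E} {a : ι → ℝ}
    (ha : ∀ i, 0 ≤ a i) (h1 : ∑ i, a i = 1) (h0 : ∑ i, a i • v i = 0) :
    0 < positiveDependence v a := by
  classical
  refine Finset.sum_pos' (fun _ _ ↦ Finset.prod_nonneg fun i _ ↦ ha i)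
    ⟨Finset.univ.filter fun i ↦ a i ≠ 0, ?_, ?_⟩
  · refine Finset.mem_filter.2 ⟨Finset.mem_univ _, a, fun i _ ↦ ha i, ?_, ?_⟩
    · rwa [Finset.sum_filter_ne_zero]
    · rw [Finset.sum_filter_of_ne, h0]
      exact fun i _ h ha0 ↦ h (by rw [ha0, zero_smul])
  · exact Finset.prod_pos fun i hi ↦ (ha i).lt_of_ne' (Finset.mem_filter.1 hi).2

theorem contDiff_positiveDependence [AddCommGroup E] [Module ℝ E] (v : ι → E) :
    ContDiff ℝ 1 (positiveDependence v) := by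
  unfold positiveDependence
  exact ContDiff.sum fun S _ ↦ contDiff_prod fun i _ ↦ contDiff_apply ℝ ℝ i

/-- A convex combination is bounded away from zero unless its positive dependence is. -/
theorem exists_pos_le_positiveDependence_or_le_norm [NormedAddCommGroup E] [NormedSpace ℝ E]
    (v : ι → E) : ∃ m : ℝ, 0 < m ∧ ∀ a : ι → ℝ, (∀ i, 0 ≤ a i) → ∑ i, a i = 1 →
      m ≤ positiveDependence v a ∨ m ≤ ‖∑ i, a i • v i‖ := by
  have hc := (contDiff_positiveDependence v).continuous
  rcases (stdSimplex ℝ ι).eq_empty_or_nonempty with h | h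
  · exact ⟨1, one_pos, fun a h1 h2 ↦ absurd (show a ∈ stdSimplex ℝ ι from ⟨h1, h2⟩) (by simp [h])⟩
  · obtain ⟨a, ha, hmin⟩ := (isCompact_stdSimplex ℝ ι).exists_isMinOn h
      (f := fun a ↦ max (positiveDependence v a) ‖∑ i, a i • v i‖) (by fun_prop)
    refine ⟨_, ?_, fun b h1 h2 ↦ le_max_iff.1 (hmin (show b ∈ stdSimplex ℝ ι from ⟨h1, h2⟩))⟩
    rw [lt_max_iff]
    by_cases h0 : ∑ i, a i • v i = 0
    · exact Or.inl (positiveDependence_pos ha.1 ha.2 h0)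
    · exact Or.inr (norm_pos_iff.2 h0)

end positiveDependence

/-! ### Norms in finite dimension. -/

/-- A seminorm has a supporting functional at each point. -/
theorem Seminorm.exists_supporting_dual {E : Type*} [AddCommGroup E] [Module ℝ E]
    (N : Seminorm ℝ E) (x : E) : ∃ l : Module.Dual ℝ E, l x = N x ∧ ∀ y, |l y| ≤ N y := by
  by_cases hx : x = 0
  · exact ⟨0, by simp [hx], fun y ↦ by simp⟩
  · let e := LinearEquiv.toSpanNonzeroSingleton ℝ E x hx
    obtain ⟨l, hl, hlN⟩ := Module.Dual.exists_extension_of_le_seminorm_real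
      (Submodule.span ℝ {x}) (N x • e.symm.toLinearMap) (p := N) (by
        intro y
        obtain ⟨c, rfl⟩ := e.surjective y
        have h1 : ((e c : Submodule.span ℝ {x}) : E) = c • x := rfl
        rw [h1, map_smul_eq_mul]
        simp only [LinearMap.smul_apply, LinearEquiv.coe_coe, LinearEquiv.symm_apply_apply,
          smul_eq_mul]
        rw [mul_comm]
        exact mul_le_mul_of_nonneg_right (le_abs_self c) (apply_nonneg N x))
    refine ⟨l, ?_, hlN⟩
    have h1 : ((e 1 : Submodule.span ℝ {x}) : E) = x := one_smul ℝ x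
    have h2 := hl (e 1)
    simpa [h1] using h2

/-- A norm on a finite-dimensional space is equivalent to the given one. -/
theorem Seminorm.exists_equiv_bounds {E : Type*} [NormedAddCommGroup E] [NormedSpace ℝ E]
    [FiniteDimensional ℝ E] (N : Seminorm ℝ E) (hN : ∀ x, N x = 0 → x = 0) :
    ∃ c L : ℝ, 0 < c ∧ 0 < L ∧ ∀ y, c * ‖y‖ ≤ N y ∧ N y ≤ L * ‖y‖ := by
  have hcont : Continuous N := by
    have := ConvexOn.continuousOn isOpen_univ N.convexOn
    exact continuousOn_univ.1 this
  obtain ⟨L, hL, hNL⟩ := Seminorm.bound_of_continuous_normedSpace N hcont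
  obtain ⟨c, hc, hcN⟩ : ∃ c : ℝ, 0 < c ∧ ∀ y ∈ Metric.sphere (0 : E) 1, c ≤ N y := by
    rcases (Metric.sphere (0 : E) 1).eq_empty_or_nonempty with h | h
    · exact ⟨1, one_pos, by simp [h]⟩
    · obtain ⟨y, hy, hmin⟩ := (isCompact_sphere (0 : E) 1).exists_isMinOn h hcont.continuousOn
      refine ⟨_, (apply_nonneg N y).lt_of_ne' fun h0 ↦ ?_, fun z hz ↦ hmin hz⟩
      simp [hN y h0] at hy
  refine ⟨c, L, hc, hL, fun y ↦ ⟨?_, hNL y⟩⟩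
  by_cases hy : y = 0
  · simp [hy]
  have hy' : 0 < ‖y‖ := norm_pos_iff.2 hy
  have := hcN (‖y‖⁻¹ • y) (by simp [norm_smul, hy'.ne'])
  rw [map_smul_eq_mul, norm_inv, norm_norm, inv_mul_eq_div, le_div_iff₀ hy'] at this
  exact this

/-! ### The vector field of a finite cover. -/

open Metric Set Manifold in
/-- Covering theorem for finitely many open sets: a set `V (φ, false)` lies in the "half-space" of
points `y` with `φ (y - x) > f (N y) - f (N x)`, while `V (φ, true)` lies near infinity in the
half-space `φ (y - x) > 0`. Then some point of multiplicity at least `dim E + 1` belongs to one of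
the sets `V (φ, true)`. -/
theorem exists_multiplicity_of_cover {E : Type*} [NormedAddCommGroup E] [InnerProductSpace ℝ E]
    [FiniteDimensional ℝ E] (N : Seminorm ℝ E) (hN : ∀ x, N x = 0 → x = 0)
    (Φ : Finset (Module.Dual ℝ E)) :
    ∃ ε : ℝ≥0, 0 < ε ∧ ∀ f : ℝ≥0 → ℝ, LipschitzWith ε f → Monotone f →
      ∀ (x : E) (T : ℝ) (V : Φ × Bool → Set E), (∀ i, IsOpen (V i)) → (∀ y, ∃ i, y ∈ V i) →
        (∀ φ : Φ, ∀ y ∈ V (φ, false),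
          f ⟨N y, apply_nonneg N y⟩ - f ⟨N x, apply_nonneg N x⟩ < φ.1 (y - x)) →
        (∀ φ : Φ, ∀ y ∈ V (φ, true), T ≤ N y → 0 < φ.1 (y - x)) →
        ∃ (y : E) (A : Finset (Φ × Bool)),
          (∀ i ∈ A, y ∈ V i) ∧ Module.finrank ℝ E < A.card ∧ ∃ φ, (φ, true) ∈ A := by
  classical
  let rep : Module.Dual ℝ E → E := fun φ ↦
    (InnerProductSpace.toDual ℝ E).symm (LinearMap.toContinuousLinearMap φ)
  have hrep : ∀ φ y, inner ℝ y (rep φ) = φ y := by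
    intro φ y
    rw [real_inner_comm]
    simp [rep]
  let v : Φ → E := fun φ ↦ rep φ
  obtain ⟨c, L, hc, hL, hcL⟩ := N.exists_equiv_bounds hN
  obtain ⟨m, hm, hmv⟩ := exists_pos_le_positiveDependence_or_le_norm v
  -- Both `ε < m` and `ε * L < m` hold, so `s < ε` contradicts either alternative in `hmv` at a zero
  -- of the field.
  let ε : ℝ≥0 := ⟨m / (L + 1), by positivity⟩
  have hε : (ε : ℝ) = m / (L + 1) := rfl
  have hεpos : (0 : ℝ) < ε := by rw [hε]; positivity
  have hεm : (ε : ℝ) * (L + 1) = m := by rw [hε]; field_simp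
  refine ⟨ε, hεpos, fun f hf hmono x T V hVo hVc hout hin ↦ ?_⟩
  obtain ⟨l, hlx, hlN⟩ := N.exists_supporting_dual x
  have hlL : ‖rep l‖ ≤ L := by
    have h1 : ‖rep l‖ ^ 2 ≤ L * ‖rep l‖ := by
      rw [← real_inner_self_eq_norm_sq, hrep]
      exact (le_abs_self _).trans ((hlN _).trans (hcL _).2)
    by_contra! h
    nlinarith
  obtain ⟨p, hp⟩ := SmoothPartitionOfUnity.exists_isSubordinate 𝓘(ℝ, E) isClosed_univ V hVo
    (fun y _ ↦ mem_iUnion.2 (hVc y))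
  have hpV : ∀ i y, p i y ≠ 0 → y ∈ V i := fun i y h ↦ hp i (subset_tsupport _ h)
  have hpsum : ∀ y, ∑ i, p i y = 1 := fun y ↦ by
    rw [← finsum_eq_sum_of_fintype]; exact p.sum_eq_one (mem_univ y)
  let G : (Φ × Bool → ℝ) → E := fun w ↦ ∑ φ, (w (φ, true) + w (φ, false)) • v φ
    - positiveDependence v (fun φ ↦ w (φ, false)) • rep l
  have hG : ContDiff ℝ 1 G := by
    refine ContDiff.sub (ContDiff.sum fun φ _ ↦ ?_) (ContDiff.smul ?_ contDiff_const)
    · exact ((contDiff_apply ℝ ℝ _).add (contDiff_apply ℝ ℝ _)).smul contDiff_const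
    · exact (contDiff_positiveDependence v).comp (contDiff_pi.2 fun φ ↦ contDiff_apply ℝ ℝ _)
  have hw : ContDiff ℝ 1 fun y i ↦ p i y :=
    contDiff_pi.2 fun i ↦ ((p i).contMDiff.contDiff).of_le (by simp)
  have hdep : ∀ y, positiveDependence v (fun φ ↦ p (φ, false) y) ≠ 0 → N y < N x := by
    intro y h
    obtain ⟨S, b, hb, hb1, hb0, hS⟩ := exists_of_positiveDependence_ne_zero h
    have h1 : ∑ φ ∈ S, b φ * φ.1 (y - x) = 0 := by
      have := congrArg (inner ℝ (y - x)) hb0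
      rw [inner_sum, inner_zero_right] at this
      rw [← this]
      exact Finset.sum_congr rfl fun φ _ ↦ by rw [inner_smul_right, hrep]
    by_contra! hle
    obtain ⟨φ, hφS, hφ⟩ := Finset.exists_ne_zero_of_sum_ne_zero (hb1.trans_ne one_ne_zero)
    have hpos : ∀ ψ ∈ S, 0 < ψ.1 (y - x) := by
      intro ψ hψ
      have h2 := hout ψ y (hpV _ _ (hS ψ hψ))
      have h3 : f ⟨N x, apply_nonneg N x⟩ ≤ f ⟨N y, apply_nonneg N y⟩ := hmono hle
      linarith
    have h4 : 0 < ∑ φ ∈ S, b φ * φ.1 (y - x) :=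
      Finset.sum_pos' (fun ψ hψ ↦ mul_nonneg (hb ψ hψ) (hpos ψ hψ).le)
        ⟨φ, hφS, mul_pos ((hb φ hφS).lt_of_ne' hφ) (hpos φ hφS)⟩
    exact h4.ne' h1
  have hinner : ∀ y, inner ℝ (y - x) (G fun i ↦ p i y) =
      ∑ φ, (p (φ, true) y + p (φ, false) y) * φ.1 (y - x)
        - positiveDependence v (fun φ ↦ p (φ, false) y) * l (y - x) := by
    intro y
    simp only [G, v]
    rw [inner_sub_right, inner_sum, inner_smul_right, hrep]
    congr 1
    exact Finset.sum_congr rfl fun φ _ ↦ by rw [inner_smul_right, hrep]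
  have hsum2 : ∀ y, ∑ φ, (p (φ, true) y + p (φ, false) y) = 1 := by
    intro y
    rw [← hpsum y, Fintype.sum_prod_type]
    exact Finset.sum_congr rfl fun φ _ ↦ by rw [Fintype.sum_bool]
  have hexists : ∀ y, ∃ φ : Φ, 0 < p (φ, true) y + p (φ, false) y := by
    intro y
    obtain ⟨φ, -, hφ⟩ := Finset.exists_ne_zero_of_sum_ne_zero ((hsum2 y).trans_ne one_ne_zero)
    exact ⟨φ, (add_nonneg (p.nonneg _ _) (p.nonneg _ _)).lt_of_ne' hφ⟩
  have hsumpos : ∀ y (h : Φ → ℝ),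
      (∀ φ, (p (φ, true) y ≠ 0 ∨ p (φ, false) y ≠ 0) → 0 < h φ) →
      0 < ∑ φ, (p (φ, true) y + p (φ, false) y) * h φ := by
    intro y h hh
    have hnn : ∀ i, 0 ≤ p i y := fun i ↦ p.nonneg i y
    have hterm : ∀ φ, 0 < p (φ, true) y + p (φ, false) y → 0 < h φ := by
      intro φ hφ
      refine hh φ ?_
      by_contra! h0
      simp [h0.1, h0.2] at hφ
    obtain ⟨φ, hφ⟩ := hexists y
    refine Finset.sum_pos' (fun ψ _ ↦ ?_) ⟨φ, Finset.mem_univ _, mul_pos hφ (hterm φ hφ)⟩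
    rcases (add_nonneg (hnn (ψ, true)) (hnn (ψ, false))).eq_or_lt with h0 | h0
    · rw [← h0, zero_mul]
    · exact (mul_pos h0 (hterm ψ h0)).le
  let W : Set E := {y | ∃ φ, p (φ, true) y ≠ 0}
  have hWo : IsOpen W := by
    have : W = ⋃ φ, {y | p (φ, true) y ≠ 0} := by ext; simp [W]
    rw [this]
    exact isOpen_iUnion fun φ ↦ isOpen_ne_fun (p (φ, true)).contMDiff.continuous continuous_const
  have hne : ∀ y ∉ W, (G fun i ↦ p i y) ≠ 0 := by
    intro y hy h0
    have hy0 : ∀ φ, p (φ, true) y = 0 := by simpa [W] using hy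
    have hs0 := positiveDependence_nonneg v (a := fun φ ↦ p (φ, false) y) fun φ ↦ p.nonneg _ _
    set s := positiveDependence v (fun φ ↦ p (φ, false) y) with hs
    have hs1 : ∑ φ, p (φ, false) y = 1 := by simpa [hy0] using hsum2 y
    -- If `ε ≤ s`, pairing the field with `y - x` gives more than `(ε - s) * l (y - x) ≥ 0`.
    by_cases hsε : (ε : ℝ) ≤ s
    · have hlt := hdep y (hεpos.trans_le hsε).ne'
      have hl : l (y - x) ≤ N y - N x := by
        rw [map_sub, hlx]
        exact sub_le_sub_right ((le_abs_self _).trans (hlN y)) _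
      have hLip : -((ε : ℝ) * (N x - N y)) ≤
          f ⟨N y, apply_nonneg N y⟩ - f ⟨N x, apply_nonneg N x⟩ := by
        have : |f ⟨N y, apply_nonneg N y⟩ - f ⟨N x, apply_nonneg N x⟩| ≤ ε * |N y - N x| :=
          hf.dist_le_mul ⟨N y, apply_nonneg N y⟩ ⟨N x, apply_nonneg N x⟩
        have h2 : |N y - N x| = N x - N y := by rw [abs_of_neg (by linarith)]; ring
        rw [h2] at this
        exact (abs_le.1 this).1
      have h3 := hsumpos y (fun φ ↦ φ.1 (y - x) - ε * l (y - x)) (by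
        intro φ hφ
        have := hout φ y (hpV _ _ (by simpa [hy0] using hφ))
        nlinarith)
      have h4 := hinner y
      rw [h0, inner_zero_right] at h4
      simp only [mul_sub, Finset.sum_sub_distrib, ← Finset.sum_mul, hsum2] at h3
      nlinarith
    · push Not at hsε
      have h5 : ∑ φ, p (φ, false) y • v φ = s • rep l := by
        have : (∑ φ, (p (φ, true) y + p (φ, false) y) • v φ) - s • rep l = 0 := h0
        simpa [hy0, sub_eq_zero] using this
      rcases hmv (fun φ ↦ p (φ, false) y) (fun φ ↦ p.nonneg _ _) hs1 with h | h
      · rw [← hs] at h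
        nlinarith
      · simp only [h5] at h
        rw [norm_smul, Real.norm_of_nonneg hs0] at h
        nlinarith [norm_nonneg (rep l)]
  -- Chosen so that `N y ≥ |T| + N x` on the sphere about `x`; hence both types push outward and `s
  -- = 0`.
  let R : ℝ := ‖x‖ + (|T| + N x) / c + 1
  have hNx := apply_nonneg N x
  have hR : 0 < R := by positivity
  have hsphere : ∀ y ∈ sphere x R, 0 < inner ℝ (y - x) (G fun i ↦ p i y) := by
    intro y hy
    have hyR : R ≤ ‖y‖ + ‖x‖ := by
      rw [← mem_sphere_iff_norm.1 hy]; exact norm_sub_le y x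
    have h1 : |T| + N x ≤ N y := by
      refine le_trans ?_ (hcL y).1
      have : (|T| + N x) / c ≤ ‖y‖ := by simp only [R] at hyR; linarith
      rwa [div_le_iff₀' hc] at this
    have hTy : T ≤ N y := by linarith [le_abs_self T]
    have hxy : N x ≤ N y := by linarith [abs_nonneg T]
    have hs : positiveDependence v (fun φ ↦ p (φ, false) y) = 0 := by
      by_contra h
      exact (hdep y h).not_ge hxy
    rw [hinner, hs, zero_mul, sub_zero]
    refine hsumpos y (fun φ ↦ φ.1 (y - x)) fun φ hφ ↦ ?_
    rcases hφ with hφ | hφ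
    · exact hin φ y (hpV _ _ hφ) hTy
    · have h2 := hout φ y (hpV _ _ hφ)
      have h3 : f ⟨N x, apply_nonneg N x⟩ ≤ f ⟨N y, apply_nonneg N y⟩ := hmono hxy
      linarith
  obtain ⟨y, ⟨φ, hφ⟩, hyZ⟩ := exists_notMem_of_outward hR (hG.comp hw) x hsphere hWo hne
    (dense_compl_image_skeleton hG)
  refine ⟨y, Finset.univ.filter fun i ↦ p i y ≠ 0,
    fun i hi ↦ hpV i y (Finset.mem_filter.1 hi).2, ?_, φ, by simpa using hφ⟩
  by_contra! hcard
  exact hyZ ⟨fun i ↦ p i y, ⟨hpsum y, hcard⟩, rfl⟩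

/-! ### Bordered sets and the main theorem. -/

/-- A bordered set lies, far away from the origin, in an open half-space bounded by a hyperplane
through `x`. -/
theorem IsBordered.exists_pos_of_le {n : ℕ} {N : Seminorm ℝ (EuclideanSpace ℝ (Fin n))}
    {Φ : Finset (Module.Dual ℝ (EuclideanSpace ℝ (Fin n)))} {f : ℝ≥0 → ℝ}
    {U : Set (EuclideanSpace ℝ (Fin n))} (hU : IsBordered N Φ f U)
    (hf : Filter.Tendsto f Filter.atTop Filter.atTop) (x : EuclideanSpace ℝ (Fin n)) :
    ∃ T : ℝ, ∃ φ ∈ Φ, ∀ y ∈ U, T ≤ N y → 0 < φ (y - x) := by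
  obtain ⟨-, Φ', hsub, ⟨φ, hφ⟩, C, rfl⟩ := hU
  obtain ⟨T, hT⟩ := (Filter.tendsto_atTop.1 hf (φ x - C φ)).exists_forall_of_atTop
  refine ⟨T, φ, hsub hφ, fun y hy hTy ↦ ?_⟩
  have h1 := hy φ hφ
  have h2 := hT ⟨N y, apply_nonneg N y⟩ hTy
  rw [map_sub]
  linarith

/-- A bordered set not containing `x` lies in a bordered set with `x` on its border. -/
theorem IsBordered.exists_lt_of_notMem {n : ℕ} {N : Seminorm ℝ (EuclideanSpace ℝ (Fin n))}
    {Φ : Finset (Module.Dual ℝ (EuclideanSpace ℝ (Fin n)))} {f : ℝ≥0 → ℝ}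
    {U : Set (EuclideanSpace ℝ (Fin n))} (hU : IsBordered N Φ f U)
    {x : EuclideanSpace ℝ (Fin n)} (hx : x ∉ U) :
    ∃ φ ∈ Φ, ∀ y ∈ U,
      f ⟨N y, apply_nonneg N y⟩ - f ⟨N x, apply_nonneg N x⟩ < φ (y - x) := by
  obtain ⟨-, Φ', hsub, -, C, rfl⟩ := hU
  simp only [Set.mem_ofPred_eq, not_forall, not_lt] at hx
  obtain ⟨φ, hφ, h⟩ := hx
  refine ⟨φ, hsub hφ, fun y hy ↦ ?_⟩
  have h1 := hy φ hφ
  rw [map_sub]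
  linarith

theorem theorem6p4 (n : ℕ)
    -- a norm on `ℝⁿ`: a seminorm that vanishes only at the origin
    (N : Seminorm ℝ (EuclideanSpace ℝ (Fin n))) (hN : ∀ x, N x = 0 → x = 0)
    (Φ : Finset (Module.Dual ℝ (EuclideanSpace ℝ (Fin n)))) :
    ∃ ε : ℝ≥0, 0 < ε ∧
      ∀ f : ℝ≥0 → ℝ, (∀ t, 0 ≤ f t) → LipschitzWith ε f → Monotone f →
        Filter.Tendsto f Filter.atTop Filter.atTop →
      ∀ 𝔘 : Set (Set (EuclideanSpace ℝ (Fin n))),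
        (∀ U ∈ 𝔘, IsOpen U) → ⋃₀ 𝔘 = Set.univ →
      ∀ E : Set (EuclideanSpace ℝ (Fin n)) → Set (EuclideanSpace ℝ (Fin n)),
        (∀ U ∈ 𝔘, IsBordered N Φ f (E U) ∧ U ⊆ E U ∧ E U ≠ Set.univ) →
        IsLocallyFiniteCollection (E '' 𝔘) →
        (∃ U : Fin (n + 1) → Set (EuclideanSpace ℝ (Fin n)),
          Function.Injective U ∧ (∀ i, U i ∈ 𝔘) ∧ (⋂ i, U i).Nonempty) ∧
        ∀ x : EuclideanSpace ℝ (Fin n),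
          ∃ U : Fin (n + 1) → Set (EuclideanSpace ℝ (Fin n)),
            Function.Injective U ∧ (∀ i, U i ∈ 𝔘) ∧ (⋂ i, U i).Nonempty ∧
              x ∈ closure (E (U 0)) := by
  classical
  obtain ⟨ε, hε, hcover⟩ := exists_multiplicity_of_cover N hN Φ
  refine ⟨ε, hε, fun f _ hLip hmono htop 𝔘 hopen hUniv E hE hlf ↦ ?_⟩
  suffices h : ∀ x : EuclideanSpace ℝ (Fin n), ∃ U : Fin (n + 1) → Set (EuclideanSpace ℝ (Fin n)),
      Function.Injective U ∧ (∀ i, U i ∈ 𝔘) ∧ (⋂ i, U i).Nonempty ∧ x ∈ closure (E (U 0)) by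
    obtain ⟨U, h1, h2, h3, -⟩ := h 0
    exact ⟨⟨U, h1, h2, h3⟩, h⟩
  intro x
  choose! T φin hφin hTin using
    fun V (hV : IsBordered N Φ f V) ↦ hV.exists_pos_of_le htop x
  choose! φout hφout hout using
    fun V (hV : IsBordered N Φ f V ∧ x ∉ V) ↦ hV.1.exists_lt_of_notMem hV.2
  let φ := fun U ↦ if x ∈ closure (E U) then φin (E U) else φout (E U)
  have hxE : ∀ U, x ∉ closure (E U) → x ∉ E U := fun U h h' ↦ h (subset_closure h')
  have hφ : ∀ U ∈ 𝔘, φ U ∈ Φ := by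
    intro U hU
    by_cases h : x ∈ closure (E U)
    · simpa only [φ, if_pos h] using hφin _ (hE U hU).1
    · simpa only [φ, if_neg h] using hφout _ ⟨(hE U hU).1, hxE U h⟩
  -- `T` depends only on `E U`, and only finitely many sets `E U` meet the unit ball about `x`, even
  -- if infinitely many `U` share them.
  obtain ⟨T₀, hT₀⟩ : ∃ T₀ : ℝ, ∀ U ∈ 𝔘, x ∈ closure (E U) → T (E U) ≤ T₀ := by
    obtain ⟨T₀, h⟩ := ((hlf _ (isCompact_closedBall x 1)).image T).bddAbove
    refine ⟨T₀, fun U hU hx ↦ h ⟨E U, ⟨⟨U, hU, rfl⟩, ?_⟩, rfl⟩⟩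
    obtain ⟨y, hy, hxy⟩ := Metric.mem_closure_iff.1 hx 1 one_pos
    exact ⟨y, hy, by rw [Metric.mem_closedBall, dist_comm]; exact hxy.le⟩
  let V : Φ × Bool → Set (EuclideanSpace ℝ (Fin n)) := fun i ↦
    ⋃₀ {U ∈ 𝔘 | φ U = i.1 ∧ decide (x ∈ closure (E U)) = i.2}
  obtain ⟨y, A, hyA, hA, ψ, hψ⟩ := hcover f hLip hmono x T₀ V
    (fun i ↦ isOpen_sUnion fun U hU ↦ hopen U hU.1)
    (fun y ↦ by
      obtain ⟨U, hU, hy⟩ := Set.mem_sUnion.1 (hUniv.symm ▸ Set.mem_univ y)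
      exact ⟨(⟨φ U, hφ U hU⟩, decide (x ∈ closure (E U))), U, ⟨hU, rfl, rfl⟩, hy⟩)
    (fun ψ y ⟨U, ⟨hU, hψ, hd⟩, hy⟩ ↦ by
      have hx : x ∉ closure (E U) := of_decide_eq_false hd
      rw [← hψ]
      simp only [φ, if_neg hx]
      exact hout _ ⟨(hE U hU).1, hxE U hx⟩ y ((hE U hU).2.1 hy))
    (fun ψ y ⟨U, ⟨hU, hψ, hd⟩, hy⟩ hTy ↦ by
      have hx : x ∈ closure (E U) := of_decide_eq_true hd
      rw [← hψ]
      simp only [φ, if_pos hx]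
      exact hTin _ (hE U hU).1 y ((hE U hU).2.1 hy) ((hT₀ U hU hx).trans hTy))
  rw [finrank_euclideanSpace_fin] at hA
  choose! u hu hyu using hyA
  obtain ⟨B, hBA, hB⟩ := Finset.exists_subset_card_eq (s := A.erase (ψ, true)) (n := n)
    (by rw [Finset.card_erase_of_mem hψ]; omega)
  -- Index `0` gets the type `true` label, which yields `x ∈ closure (E (U 0))`.
  let k : Fin (n + 1) → Φ × Bool := Fin.cons (ψ, true) fun j ↦ B.equivFin.symm (finCongr hB.symm j)
  have hk : Function.Injective k := by
    refine Fin.cons_injective_iff.2 ⟨?_, ?_⟩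
    · rintro ⟨j, hj⟩
      have := hBA (B.equivFin.symm (finCongr hB.symm j)).2
      exact Finset.ne_of_mem_erase this hj
    · exact Subtype.val_injective.comp
        (B.equivFin.symm.injective.comp (finCongr hB.symm).injective)
  have hkA : ∀ j, k j ∈ A := by
    refine Fin.cases hψ fun j ↦ ?_
    exact Finset.mem_of_mem_erase (hBA (B.equivFin.symm (finCongr hB.symm j)).2)
  refine ⟨fun j ↦ u (k j), fun i j hij ↦ hk ?_, fun j ↦ (hu _ (hkA j)).1,
    ⟨y, Set.mem_iInter.2 fun j ↦ hyu _ (hkA j)⟩, of_decide_eq_true (hu _ (hkA 0)).2.2⟩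
  -- The set `U` determines its label, so distinct labels give distinct members of `𝔘`.
  have hi := (hu _ (hkA i)).2
  have hj := (hu _ (hkA j)).2
  simp only at hij
  rw [hij] at hi
  exact Prod.ext (Subtype.ext (hi.1.symm.trans hj.1)) (hi.2.symm.trans hj.2)
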